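/- Let $p$ be a prime and let $n,k,d,e$ be integers with $k\ge 1$, $e\ge 0$, $k+2e\le d\le n-1$; put $s=d-2e-k+1$. Let $p_1,\dots,p_n$ be distinct primes with $p_i\equiv 1 \pmod s$, let $\alpha_i$ be an element of degree $p_i$ over $\mathbb F_p$ ($i=1,\dots,n$), let $\mathbb F=\mathbb F_p(\alpha_1,\dots,\alpha_n)$, and let $\mathbb K=\mathbb F(\beta)$ with $\beta$ of degree $s$ over $\mathbb F$. Let $\mathcal C=\{(g(\alpha_1),\dots,g(\alpha_n)) : g\in\mathbb K[x],\ \deg g<k\}$ be the Reed–Solomon code over $\mathbb K$ with evaluation points $\alpha_1,\dots,\alpha_n$ (these are distinct). Write $\mathrm{GRS}_F(m,v,a)=\{(v_jg(a_j))_j : g\in F[x],\ \deg g<m\}$, where the $a_j$ are distinct and all $v_j\ne 0$. There is $v\in(\mathbb K^*)^n$ with $\mathcal C^\perp=\mathrm{GRS}_{\mathbb K}(n-k,v,(\alpha_j)_{1\le j\le n})$; fix any such $v$. Fix a node $i\in\{1,\dots,n\}$ and put $P=p_i$, $F_i=\mathbb F_p(\alpha_j : j\ne i)$, and let $f$ be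 the minimal polynomial of $\alpha_i$ over $F_i$. Then $[\mathbb K:F_i]=sP$. Put $e_{u+qs}=\beta^u\alpha_i^{u+qs}$ for $0\le u\le s-1$, $0\le q\le \frac{P-1}{s}-1$, and $e_{P-1}=\sum_{u=0}^{s-1}\beta^u\alpha_i^{P-1}$. For a codeword $c\in\mathcal C$ and $j\neq i$ let $r_j=(r_{m,j})_{0\le m\le P-1}\in F_i^{P}$, $r_{m,j}=\mathrm{tr}_{\mathbb K/F_i}(e_m v_j c_j)$. For $0\le h\le s-1$ let $f_h=x^{P+h}\bmod f$, and write uniquely $f_h=\sum_{q=0}^{(P-1)/s-1}x^{qs}f_{h,q}$ with $f_{h,q}\in F_i[x]$, $\deg f_{h,q}\le s-1$ for $q<\frac{P-1}{s}-1$, and $\deg f_{h,q}\le s$ for $q=\frac{P-1}{s}-1$. For $j\ne i$ let $M_j$ be the $P\times P$ matrix over $F_i$ of the linear map $r_j\mapsto z_j=(z_{j,0},\dots,z_{j,P-1})$ given by $$z_{j,m}=\alpha_j^s r_{m,j}-r_{m+s,j}\quad(0\le m\le P-s-2),\qquad z_{j,P-s-1}=\sum_{u=0}^{s-1}\alpha_j^{s-u}r_{u+P-s-1,j}-r_{P-1,j},$$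 $$z_{j,P-s+h}=\sum_{u=0}^{h}\sum_{q=0}^{(P-1)/s-1}f_{h-u,q}(\alpha_j)\,r_{u+qs,j}+\sum_{u=h+1}^{s-1}\alpha_j^{h+1-u+s}r_{u+P-s-1,j}-\alpha_j^{h+1}r_{P-1,j}\quad(0\le h\le s-1).$$ Then: 1. Every $M_j$, $j\ne i$, is invertible. 2. There is $w=(w_j)_{j\neq i}$ with all $w_j\in F_i^*$ such that for every $c\in\mathcal C$ and every $0\le m\le P-1$ the vector $(z_{j,m})_{j\ne i}$ belongs to the code $\mathrm{GRS}_{F_i}(s+k-1,w,(\alpha_j)_{j\ne i})$ of length $n-1$. 3. Let $R\subseteq\{1,\dots,n\}\setminus\{i\}$ be any set of $d$ helper nodes. There is a map $\mathbf g$ that recovers $c_i$, for every $c\in\mathcal C$, from any vectors $\hat r_j\in F_i^{P}$ ($j\in R$) with $\hat r_j\ne r_j$ for at most $e$ indices $j\in R$. This scheme downloads $dP=\frac{dl}{d-2e-k+1}$ symbols of $F_i$, where $l=[\mathbb K:F_i]$, and this is the minimum: any scheme (with arbitrary functions $\mathbb K\to F_i^{b_j}$ computed by the helpers $j\in R$ and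 an arbitrary recovery function) that recovers $c_i$ for every $c\in\mathcal C$ whenever at most $e$ of the helpers in $R$ send erroneous data downloads $\sum_{j\in R}b_j\ge\frac{dl}{d-2e-k+1}$ symbols. Likewise, with symbols counted over $\mathbb F_p$ and $l=[\mathbb K:\mathbb F_p]$, the minimum number of symbols downloaded from $R$ by such schemes is $\frac{dl}{d-2e-k+1}$. -/

import Mathlib

open Polynomial

noncomputable section

/-- The generalized Reed–Solomon code `GRS_F(n, m, v, a)` with evaluation points `a`, column
multipliers `v` and dimension parameter `m`: all vectors `(v_j f(a_j))_j` with `deg f < m`. -/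
def grsCode {F ι : Type*} [Field F] (m : ℕ) (v a : ι → F) : Submodule F (ι → F) where
  carrier := {c | ∃ f : F[X], f.degree < m ∧ ∀ j, c j = v j * f.eval (a j)}
  add_mem' := by
    rintro c c' ⟨f, hf, hc⟩ ⟨g, hg, hc'⟩
    refine ⟨f + g, lt_of_le_of_lt (degree_add_le f g) (max_lt hf hg), fun j => ?_⟩
    simp [hc j, hc' j, mul_add]
  zero_mem' := ⟨0, by simp, by simp⟩
  smul_mem' := by
    rintro r c ⟨f, hf, hc⟩
    refine ⟨r • f, lt_of_le_of_lt (degree_smul_le r f) hf, fun j => ?_⟩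
    simp [hc j, mul_left_comm]

/-- The Reed–Solomon code `RS_F(n, k, a)`. -/
def rsCode {F ι : Type*} [Field F] (k : ℕ) (a : ι → F) : Submodule F (ι → F) :=
  grsCode k (fun _ => 1) a

/-- The dual code with respect to the standard bilinear form `∑_j w_j c_j`. -/
def dualCode {F ι : Type*} [Field F] [Fintype ι] (C : Submodule F (ι → F)) :
    Submodule F (ι → F) where
  carrier := {w | ∀ c ∈ C, ∑ j, w j * c j = 0}
  add_mem' := by
    intro w w' hw hw' c hc
    simp [add_mul, Finset.sum_add_distrib, hw c hc, hw' c hc]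
  zero_mem' := by intro c _; simp
  smul_mem' := by
    intro r w hw c hc
    simp [mul_assoc, ← Finset.mul_sum, hw c hc]

/-- Repair in the presence of errors. `C` is a code over `K`, each of whose coordinates is viewed
as a vector over the subfield `B`. Helper `j ∈ R` sends the `b j` symbols `f j (c j)` of `B`. The
scheme repairs node `i` if some map `g` recovers `c i` from what is received, for every codeword
`c`, whenever the data received from at most `e` of the helpers differ (arbitrarily) from what
these helpers should have sent. -/
def RepairsWithErrors (B : Type*) {K ι : Type*} [Field B] [Field K] (C : Submodule K (ι → K))
    (i : ι) (R : Finset ι) (e : ℕ) (b : R → ℕ) (f : (j : R) → K → (Fin (b j) → B)) : Prop :=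
  ∃ g : ((j : R) → Fin (b j) → B) → K,
    ∀ c ∈ C, ∀ y : (j : R) → Fin (b j) → B,
      {j : R | y j ≠ f j (c j)}.ncard ≤ e → g y = c i

/-- The numbers of symbols of `B` whose download from the set `R` of helpers suffices, for some
repair scheme, to repair node `i` in the presence of at most `e` erroneous helpers. -/
def repairBandwidths (B : Type*) {K ι : Type*} [Field B] [Field K] (C : Submodule K (ι → K))
    (i : ι) (R : Finset ι) (e : ℕ) : Set ℕ :=
  {N | ∃ (b : R → ℕ) (f : (j : R) → K → (Fin (b j) → B)),
    RepairsWithErrors B C i R e b f ∧ ∑ j, b j = N}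

/-- The field `𝔽 = 𝔽_p(α_1, …, α_n)`. -/
abbrev pointField (p : ℕ) [Fact p.Prime] {n : ℕ} {K : Type*} [Field K] [Algebra (ZMod p) K]
    (α : Fin n → K) : IntermediateField (ZMod p) K :=
  IntermediateField.adjoin (ZMod p) (Set.range α)

/-- The field `F_i = 𝔽_p(α_j : j ≠ i)` over which node `i` is repaired. -/
abbrev repairField (p : ℕ) [Fact p.Prime] {n : ℕ} {K : Type*} [Field K] [Algebra (ZMod p) K]
    (α : Fin n → K) (i : Fin n) : IntermediateField (ZMod p) K :=
  IntermediateField.adjoin (ZMod p) (α '' {j | j ≠ i})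

/-- The evaluation point `α_j`, `j ≠ i`, as an element of `F_i`. -/
def helperPoint (p : ℕ) [Fact p.Prime] {n : ℕ} {K : Type*} [Field K] [Algebra (ZMod p) K]
    (α : Fin n → K) (i : Fin n) (j : {j : Fin n // j ≠ i}) : repairField p α i :=
  ⟨α j, IntermediateField.subset_adjoin _ _ ⟨j, j.2, rfl⟩⟩

/-- The elements `e_0, …, e_{P-1}`: `e_{u+qs} = β^u α^{u+qs}` for `0 ≤ u < s` and
`0 ≤ q < (P-1)/s`, and `e_{P-1} = ∑_{u<s} β^u α^{P-1}`. -/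
def repairElement {K : Type*} [Field K] (s P : ℕ) (α β : K) (m : ℕ) : K :=
  if m = P - 1 then ∑ u ∈ Finset.range s, β ^ u * α ^ (P - 1) else β ^ (m % s) * α ^ m

/-- What a helper with dual multiplier `v` and content `x` sends: the vector
`(tr_{K/F}(e_m v x))_{0 ≤ m < P}` over `F`. -/
def traceVector (F : Type*) {K : Type*} [Field F] [Field K] [Algebra F K] (s P : ℕ)
    (α β v x : K) : Fin P → F :=
  fun m => Algebra.trace F K (repairElement s P α β m * v * x)

/-- The polynomials `f_{h,q}`, `0 ≤ q < (P-1)/s`: with `f_h = X^{P+h} mod f`, they are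
determined by `f_h = ∑_q X^{qs} f_{h,q}`, `deg f_{h,q} < s` for `q < (P-1)/s - 1`, and
`deg f_{h,q} ≤ s` for `q = (P-1)/s - 1`. -/
def blockPoly {F : Type*} [Field F] (s P : ℕ) (f : F[X]) (h q : ℕ) : F[X] :=
  ∑ t ∈ Finset.range (if q + 1 = (P - 1) / s then s + 1 else s),
    C ((X ^ (P + h) %ₘ f).coeff (q * s + t)) * X ^ t

/-- The `t`-th unit row vector of length `P`. -/
def unitRow (F : Type*) [Field F] (P t : ℕ) : Fin P → F :=
  fun m => if (m : ℕ) = t then 1 else 0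

/-- The `P × P` matrix `M` for a helper with evaluation point `a`; `f` is the minimal polynomial
of the evaluation point of the failed node. Row by row, `z = M r` reads
* `z_m = a^s r_m - r_{m+s}` for `0 ≤ m ≤ P-s-2`,
* `z_{P-s-1} = ∑_{u<s} a^{s-u} r_{u+P-s-1} - r_{P-1}`,
* `z_{P-s+h} = ∑_{u≤h} ∑_q f_{h-u,q}(a) r_{u+qs} + ∑_{h<u<s} a^{h+1-u+s} r_{u+P-s-1}
    - a^{h+1} r_{P-1}` for `0 ≤ h ≤ s-1`. -/
def repairMatrix {F : Type*} [Field F] (s P : ℕ) (f : F[X]) (a : F) :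
    Matrix (Fin P) (Fin P) F :=
  Matrix.of fun m =>
    if (m : ℕ) + s + 1 < P then
      a ^ s • unitRow F P m - unitRow F P (m + s)
    else if (m : ℕ) + s + 1 = P then
      ∑ u ∈ Finset.range s, a ^ (s - u) • unitRow F P (u + (P - s - 1)) - unitRow F P (P - 1)
    else
      ∑ u ∈ Finset.range (m + s - P + 1), ∑ q ∈ Finset.range ((P - 1) / s),
          (blockPoly s P f (m + s - P - u) q).eval a • unitRow F P (u + q * s)
        + ∑ u ∈ Finset.Ico (m + s - P + 1) s,
          a ^ (m + s - P + 1 + s - u) • unitRow F P (u + (P - s - 1))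
        - a ^ (m + s - P + 1) • unitRow F P (P - 1)

end

/-! Write `F = F_i`, `a_j = α_j` for `j ≠ i`, and `l = [K : F] = s P`. The mechanism is a family of
polynomials `g_m ∈ K[x]` (`rowPoly`), `m < P`, of degree at most `s`, whose value at `a_j` is the
combination of `e_0, …, e_{P-1}` given by row `m` of `M_j`, and which vanish at `α_i`. For `H ∈
F[x]` of degree below `n - k - s`, the product `g_m H` gives a dual codeword. Node `i` drops out of
its parity check, and applying the trace yields `∑_{j ≠ i} H(a_j) z_{j,m} = 0`. So the vector of the
`z_{j,m}` lies in the dual of a Reed–Solomon code of length `n - 1`, which is a GRS code of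
dimension parameter `s + k - 1` (`mulVec_traceVector_mem_grsCode`).

The identities behind `g_m(α_i) = 0` are formal, so they can be reused over `F[X]` with `α = a_j`
and `β = X`. There the first `P - s` rows still give zero, and the last `s` give polynomials in `X`
of degrees `0, …, s - 1` with top coefficients `-a_j^h f(a_j) ≠ 0`. This independence, together with
a triangular shape of the other rows, makes `M_j` invertible (`isUnit_repairMatrix`).

For recovery, by linearity, consider a codeword whose messages are nonzero at no more than `2e`
helpers. Each `z_{·,m}` comes from a polynomial of degree below `s + k - 1 = d - 2e` with at least
`d - 2e` zeros, so it is zero. Invertibility then kills the messages at all `j ≠ i`. The parity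
checks from `e_m x^t`, `t < s`, give `tr(e_m α_i^t v_i c_i) = 0`. As the `e_m α_i^t` span `K` over
`F`, nondegeneracy of the trace form gives `c_i = 0`.

Optimality is a cut-set argument: put aside `k - 1` helpers where the codewords vanish and `2e`
helpers that errors can mask; the remaining `s` must distinguish all values of `c_i`, so they send
at least `l` symbols. Averaging over sets of `s` helpers gives `d l ≤ s ∑ b_j`. Over the prime field
the bound is the same, and expanding each symbol in a basis attains it. -/

noncomputable section

/-! ### Reed–Solomon codes, their duals and their distance -/

section Codes

variable {F ι : Type*} [Field F]

theorem mem_rsCode_iff {k : ℕ} {a : ι → F} {c : ι → F} :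
    c ∈ rsCode k a ↔ ∃ f : F[X], f.degree < k ∧ ∀ j, c j = f.eval (a j) := by
  change (∃ f : F[X], f.degree < k ∧ ∀ j, c j = 1 * f.eval (a j)) ↔ _
  simp

theorem mem_dualCode_rsCode_iff [Fintype ι] {k : ℕ} {a : ι → F} {w : ι → F} :
    w ∈ dualCode (rsCode k a) ↔
      ∀ f : F[X], f.degree < k → ∑ j, w j * f.eval (a j) = 0 := by
  constructor
  · intro h f hf
    exact h (fun j => f.eval (a j)) (mem_rsCode_iff.2 ⟨f, hf, fun _ => rfl⟩)
  · rintro h c hc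
    obtain ⟨f, hf, hc⟩ := mem_rsCode_iff.1 hc
    simpa [hc] using h f hf

/-- The sum of the values of a polynomial of small degree, weighted by the nodal weights, is its
top coefficient. -/
theorem sum_nodalWeight_mul_eval [Fintype ι] [DecidableEq ι] {a : ι → F}
    (ha : Function.Injective a) {f : F[X]} (hf : f.degree < Fintype.card ι) :
    ∑ j, Lagrange.nodalWeight Finset.univ a j * f.eval (a j) = f.coeff (Fintype.card ι - 1) := by
  rw [← Finset.card_univ] at hf ⊢
  rw [Lagrange.coeff_eq_sum (s := Finset.univ) ha.injOn hf]
  refine Finset.sum_congr rfl fun j _ => ?_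
  rw [Lagrange.nodalWeight, div_eq_mul_inv, mul_comm, Finset.prod_inv_distrib]

/-- The dual of a Reed–Solomon code is a generalized Reed–Solomon code. -/
theorem dualCode_rsCode [Fintype ι] [DecidableEq ι] {a : ι → F} (ha : Function.Injective a)
    {m : ℕ} (hm : m ≤ Fintype.card ι) :
    dualCode (rsCode m a) =
      grsCode (Fintype.card ι - m) (Lagrange.nodalWeight Finset.univ a) a := by
  have hw : ∀ j, Lagrange.nodalWeight Finset.univ a j ≠ 0 := fun j =>
    Lagrange.nodalWeight_ne_zero ha.injOn (Finset.mem_univ j)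
  ext z
  rw [mem_dualCode_rsCode_iff]
  constructor
  · intro hz
    set g := Lagrange.interpolate Finset.univ a
      (fun j => z j / Lagrange.nodalWeight Finset.univ a j) with hg
    have hgdeg : g.degree < Fintype.card ι := by
      rw [← Finset.card_univ]
      exact Lagrange.degree_interpolate_lt _ ha.injOn
    have hgeval : ∀ j, z j = Lagrange.nodalWeight Finset.univ a j * g.eval (a j) := by
      intro j
      rw [hg, Lagrange.eval_interpolate_at_node _ ha.injOn (Finset.mem_univ j),
        mul_div_cancel₀ _ (hw j)]
    refine ⟨g, ?_, hgeval⟩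
    by_contra hlt
    have hg0 : g ≠ 0 := by
      rintro h0
      apply hlt
      rw [h0, degree_zero]
      exact WithBot.bot_lt_coe _
    rw [degree_eq_natDegree hg0] at hlt hgdeg
    norm_cast at hlt hgdeg
    -- If `deg g` were too large, this monomial would be an admissible test polynomial raising `g`
    -- to degree exactly `card ι - 1`. The weighted sum then equals the leading coefficient of `g`,
    -- which must vanish.
    have h1 := hz (X ^ (Fintype.card ι - 1 - g.natDegree)) (by
      rw [degree_X_pow]; norm_cast; omega)
    have h2 : (g * X ^ (Fintype.card ι - 1 - g.natDegree)).natDegree = Fintype.card ι - 1 := by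
      rw [natDegree_mul hg0 (pow_ne_zero _ X_ne_zero), natDegree_X_pow]; omega
    have h3 := sum_nodalWeight_mul_eval ha
      (f := g * X ^ (Fintype.card ι - 1 - g.natDegree)) (by
        rw [degree_eq_natDegree (mul_ne_zero hg0 (pow_ne_zero _ X_ne_zero)), h2]
        norm_cast; omega)
    have h4 : (g * X ^ (Fintype.card ι - 1 - g.natDegree)).coeff (Fintype.card ι - 1) =
        g.leadingCoeff := by
      have h5 := coeff_natDegree (p := g * X ^ (Fintype.card ι - 1 - g.natDegree))
      rwa [h2, leadingCoeff_mul, leadingCoeff_X_pow, mul_one] at h5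
    rw [h4] at h3
    apply hg0
    rw [← leadingCoeff_eq_zero, ← h3, ← h1]
    refine Finset.sum_congr rfl fun j _ => ?_
    rw [eval_mul, hgeval j, mul_assoc]
  · rintro ⟨g, hg, hz⟩ f hf
    by_cases hf0 : f = 0
    · simp [hf0]
    by_cases hg0 : g = 0
    · simp [hz, hg0]
    have hfg : f * g ≠ 0 := mul_ne_zero hf0 hg0
    have hd : (f * g).natDegree + 1 < Fintype.card ι := by
      rw [degree_eq_natDegree hf0] at hf
      rw [degree_eq_natDegree hg0] at hg
      norm_cast at hf hg
      rw [natDegree_mul hf0 hg0]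
      omega
    have h := sum_nodalWeight_mul_eval ha (f := f * g) (by
      rw [degree_eq_natDegree hfg]; norm_cast; omega)
    rw [coeff_eq_zero_of_natDegree_lt (by omega)] at h
    rw [← h]
    refine Finset.sum_congr rfl fun j _ => ?_
    rw [hz, eval_mul]; ring

/-- A Reed–Solomon codeword vanishing at `k - 1` given places takes any given value at another. -/
theorem exists_mem_rsCode_vanishing {k : ℕ} {a : ι → F} (ha : Function.Injective a)
    (B : Finset ι) (hB : B.card < k) {i : ι} (hi : i ∉ B) (x : F) :
    ∃ c ∈ rsCode k a, (∀ j ∈ B, c j = 0) ∧ c i = x := by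
  have h0 : (Lagrange.nodal B a).eval (a i) ≠ 0 :=
    Lagrange.eval_nodal_not_at_node fun j hj h => hi (ha h ▸ hj)
  rcases eq_or_ne x 0 with rfl | hx
  · exact ⟨0, Submodule.zero_mem _, fun _ _ => rfl, rfl⟩
  refine ⟨_, mem_rsCode_iff.2 ⟨C (x / (Lagrange.nodal B a).eval (a i)) * Lagrange.nodal B a,
    ?_, fun _ => rfl⟩, fun j hj => ?_, ?_⟩
  · rw [degree_C_mul (div_ne_zero hx h0), Lagrange.degree_nodal]
    exact_mod_cast hB
  · simp [Lagrange.eval_nodal_at_node hj]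
  · simp [h0]

/-- A polynomial of degree less than `m` whose values at `d` distinct points vanish with at most
`d - m` exceptions is zero. -/
theorem eq_zero_of_ncard_eval_ne_zero_le {f : F[X]} {m t : ℕ} (hf : f.degree < m) {a : ι → F}
    (R : Finset ι) (ha : Set.InjOn a R) (hR : m + t ≤ R.card)
    (h : {j : R | f.eval (a j) ≠ 0}.ncard ≤ t) : f = 0 := by
  classical
  rw [Set.ncard_eq_toFinset_card'] at h
  set S := R.filter fun j => f.eval (a j) = 0 with hS
  have hcard : (R.filter fun j => ¬ f.eval (a j) = 0).card ≤ t := by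
    refine le_trans (le_of_eq ?_) h
    symm
    refine Finset.card_bij (fun (j : R) _ => (j : ι)) ?_ ?_ ?_
    · intro j hj
      simp only [Set.mem_toFinset, Set.mem_ofPred_eq] at hj
      exact Finset.mem_filter.2 ⟨j.2, hj⟩
    · intro j _ j' _ hjj
      exact Subtype.ext hjj
    · intro j hj
      rw [Finset.mem_filter] at hj
      exact ⟨⟨j, hj.1⟩, by simpa using hj.2, rfl⟩
  refine Polynomial.eq_zero_of_degree_lt_of_eval_index_eq_zero (s := S) (v := a)
    (ha.mono (Finset.coe_subset.2 (Finset.filter_subset _ _))) (lt_of_lt_of_le hf ?_) ?_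
  · have hsum : S.card + (R.filter fun j => ¬ f.eval (a j) = 0).card = R.card :=
      Finset.card_filter_add_card_filter_not _
    norm_cast; omega
  · intro j hj
    exact (Finset.mem_filter.1 hj).2

end Codes

/-! ### The cut-set lower bound and change of base field -/

section Bandwidth

/-- If every `s` of the `d` values have sum at least `l`, then `d * l ≤ s * ∑ b`. -/
theorem zmod_mul_le_mul_sum (d : ℕ) [NeZero d] (b : ZMod d → ℕ) {s l : ℕ}
    (hs : s ≤ d) (h : ∀ A : Finset (ZMod d), A.card = s → l ≤ ∑ j ∈ A, b j) :
    d * l ≤ s * ∑ j, b j := by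
  classical
  -- Averaging over the `d` cyclic windows of length `s` suffices: each index lies in exactly `s` of
  -- them.
  have hinj : ∀ t : ZMod d, Set.InjOn (fun u : ℕ => t + (u : ZMod d)) (Finset.range s) := by
    intro t u hu u' hu' huu
    have := add_left_cancel huu
    simp only [Finset.coe_range, Set.mem_Iio] at hu hu'
    rw [ZMod.natCast_eq_natCast_iff'] at this
    rwa [Nat.mod_eq_of_lt (by omega), Nat.mod_eq_of_lt (by omega)] at this
  have h1 : ∀ t : ZMod d, l ≤ ∑ u ∈ Finset.range s, b (t + (u : ZMod d)) := by
    intro t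
    rw [← Finset.sum_image (f := b) (hinj t)]
    exact h _ (by rw [Finset.card_image_of_injOn (hinj t), Finset.card_range])
  calc d * l = ∑ _t : ZMod d, l := by
        rw [Finset.sum_const, Finset.card_univ, ZMod.card, smul_eq_mul]
    _ ≤ ∑ t : ZMod d, ∑ u ∈ Finset.range s, b (t + (u : ZMod d)) :=
        Finset.sum_le_sum fun t _ => h1 t
    _ = ∑ u ∈ Finset.range s, ∑ t : ZMod d, b (t + (u : ZMod d)) := Finset.sum_comm
    _ = ∑ _u ∈ Finset.range s, ∑ j, b j :=
        Finset.sum_congr rfl fun u _ => Equiv.sum_comp (Equiv.addRight (u : ZMod d)) b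
    _ = s * ∑ j, b j := by rw [Finset.sum_const, Finset.card_range, smul_eq_mul]

/-- If every `s` of the `d` values have sum at least `l`, then `d * l ≤ s * ∑ b`. -/
theorem card_mul_le_mul_sum {ι : Type*} [Fintype ι] (b : ι → ℕ) {s d l : ℕ}
    (hd : Fintype.card ι = d) (hs : s ≤ d)
    (h : ∀ A : Finset ι, A.card = s → l ≤ ∑ j ∈ A, b j) : d * l ≤ s * ∑ j, b j := by
  rcases Nat.eq_zero_or_pos d with h0 | h0
  · simp [h0]
  have : NeZero d := ⟨h0.ne'⟩
  let E : ZMod d ≃ ι := Fintype.equivOfCardEq (by rw [ZMod.card, hd])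
  rw [← Equiv.sum_comp E b]
  refine zmod_mul_le_mul_sum d (fun t => b (E t)) hs fun A hA => ?_
  have := h (A.map E.toEmbedding) (by rw [Finset.card_map, hA])
  rwa [Finset.sum_map] at this

/-- Two sets of messages that differ for at most `2 * e` helpers can be mistaken for the same
received data. -/
theorem RepairsWithErrors.apply_eq_of_ncard_le {B K ι : Type*} [Field B] [Field K]
    {C : Submodule K (ι → K)} {i : ι} {R : Finset ι} {e : ℕ} {b : R → ℕ}
    {f : (j : R) → K → (Fin (b j) → B)} (h : RepairsWithErrors B C i R e b f)
    {c c' : ι → K} (hc : c ∈ C) (hc' : c' ∈ C)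
    (hcc : {j : R | f j (c j) ≠ f j (c' j)}.ncard ≤ 2 * e) : c i = c' i := by
  classical
  obtain ⟨g, hg⟩ := h
  set D : Set R := {j : R | f j (c j) ≠ f j (c' j)} with hD
  obtain ⟨D₁, hD₁, hcard⟩ : ∃ D₁ ⊆ D, D₁.ncard = min e D.ncard :=
    Set.exists_subset_card_eq (min_le_right _ _)
  -- A word halfway between the two message families: it is at distance at most `e` from each.
  let y : (j : R) → Fin (b j) → B := fun j => if j ∈ D₁ then f j (c' j) else f j (c j)
  rw [← hg c hc y, ← hg c' hc' y]
  · refine le_trans (Set.ncard_le_ncard (t := D \ D₁) ?_ (Set.toFinite _)) ?_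
    · intro j hj
      by_cases hj1 : j ∈ D₁
      · simp [y, hj1] at hj
      · exact ⟨by simpa [y, hj1, hD] using hj, hj1⟩
    · rw [Set.ncard_sdiff hD₁ (Set.toFinite _)]
      omega
  · refine le_trans (Set.ncard_le_ncard (t := D₁) ?_ (Set.toFinite _)) ?_
    · intro j hj
      by_contra hj1
      simp [y, hj1] at hj
    · omega

/-- The converse: if codewords whose messages differ for at most `2 * e` helpers agree at node `i`,
then node `i` can be repaired. -/
theorem repairsWithErrors_of_apply_eq {B K ι : Type*} [Field B] [Field K]
    {C : Submodule K (ι → K)} {i : ι} {R : Finset ι} {e : ℕ} {b : R → ℕ}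
    {f : (j : R) → K → (Fin (b j) → B)}
    (h : ∀ c ∈ C, ∀ c' ∈ C, {j : R | f j (c j) ≠ f j (c' j)}.ncard ≤ 2 * e → c i = c' i) :
    RepairsWithErrors B C i R e b f := by
  classical
  refine ⟨fun y => if hy : ∃ c ∈ C, {j : R | y j ≠ f j (c j)}.ncard ≤ e then hy.choose i else 0,
    fun c hc y hy => ?_⟩
  have hex : ∃ c ∈ C, {j : R | y j ≠ f j (c j)}.ncard ≤ e := ⟨c, hc, hy⟩
  change dite _ _ _ = _
  rw [dif_pos hex]
  obtain ⟨h1, h2⟩ := hex.choose_spec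
  refine h _ h1 c hc ?_
  refine le_trans (Set.ncard_le_ncard
    (t := {j : R | y j ≠ f j (hex.choose j)} ∪ {j : R | y j ≠ f j (c j)}) ?_ (Set.toFinite _))
    (le_trans (Set.ncard_union_le _ _) (by omega))
  intro j hj
  by_contra hcon
  simp only [Set.mem_union, Set.mem_ofPred_eq, not_or, not_not] at hcon
  exact hj (hcon.1.symm.trans hcon.2)

/-- Any `d - 2e - k + 1` helpers together send at least as many symbols as the failed node holds. -/
theorem RepairsWithErrors.finrank_le_sum {B K ι : Type*} [Field B] [Field K] [Algebra B K]
    [Finite K] {k e s : ℕ} {a : ι → K} (ha : Function.Injective a) {i : ι} {R : Finset ι}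
    (hi : i ∉ R) (hk : 1 ≤ k) (hR : R.card + 1 = s + k + 2 * e) {b : R → ℕ}
    {f : (j : R) → K → (Fin (b j) → B)} (h : RepairsWithErrors B (rsCode k a) i R e b f)
    (A : Finset R) (hA : A.card = s) : Module.finrank B K ≤ ∑ j ∈ A, b j := by
  classical
  have : Finite B := Finite.of_injective _ (algebraMap B K).injective
  have := Fintype.ofFinite B
  have := Fintype.ofFinite K
  by_contra! hlt
  have hAc : Aᶜ.card + s = R.card := by
    rw [Finset.card_compl, hA, Fintype.card_coe]
    have := hA ▸ Finset.card_le_univ A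
    rw [Fintype.card_coe] at this
    omega
  -- Outside `A` and `T` exactly `2e` helpers remain, since `|R| = s + (k - 1) + 2e`.
  obtain ⟨T, hTA, hT⟩ := Finset.exists_subset_card_eq (show k - 1 ≤ Aᶜ.card by omega)
  have hTi : i ∉ T.map (Function.Embedding.subtype _) := by
    simp [hi]
  choose c hcC hc0 hci using fun x : K =>
    exists_mem_rsCode_vanishing ha (k := k) (T.map (Function.Embedding.subtype _))
      (by rw [Finset.card_map]; omega) hTi x
  have hcard : Fintype.card ((j : A) → Fin (b j) → B) < Fintype.card K := by
    rw [Module.card_eq_pow_finrank (K := B) (V := K), Fintype.card_pi]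
    simp only [Fintype.card_fun, Fintype.card_fin]
    rw [Finset.prod_pow_eq_pow_sum, Finset.sum_coe_sort A b]
    exact Nat.pow_lt_pow_right Fintype.one_lt_card hlt
  -- Pigeonhole: fewer than `|K|` messages are available to `A`, so two values of `c i` look alike
  -- there.
  obtain ⟨x, x', hxx, hmsg⟩ := Fintype.exists_ne_map_eq_of_card_lt
    (fun (x : K) (j : A) => f j (c x j)) hcard
  apply hxx
  rw [← hci x, ← hci x']
  refine h.apply_eq_of_ncard_le (hcC x) (hcC x') ?_
  refine le_trans (Set.ncard_le_ncard (t := ((Aᶜ \ T : Finset R) : Set R)) ?_ (Set.toFinite _)) ?_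
  · intro j hj
    simp only [Finset.coe_sdiff, Finset.coe_compl, Set.mem_sdiff, Set.mem_compl_iff,
      Finset.mem_coe]
    refine ⟨fun hjA => hj (congrFun hmsg ⟨j, hjA⟩), fun hjT => hj ?_⟩
    have hj' : (j : ι) ∈ T.map (Function.Embedding.subtype _) := by
      simpa using hjT
    rw [hc0 x j hj', hc0 x' j hj']
  · rw [Set.ncard_coe_finset, Finset.card_sdiff_of_subset hTA]
    omega

/-- The cut-set bound for repair with errors. -/
theorem RepairsWithErrors.card_mul_finrank_le {B K ι : Type*} [Field B] [Field K] [Algebra B K]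
    [Finite K] {k e s : ℕ} {a : ι → K} (ha : Function.Injective a) {i : ι} {R : Finset ι}
    (hi : i ∉ R) (hk : 1 ≤ k) (hR : R.card + 1 = s + k + 2 * e) {b : R → ℕ}
    {f : (j : R) → K → (Fin (b j) → B)} (h : RepairsWithErrors B (rsCode k a) i R e b f) :
    R.card * Module.finrank B K ≤ s * ∑ j, b j := by
  exact card_mul_le_mul_sum b (Fintype.card_coe R) (by omega) (h.finrank_le_sum ha hi hk hR)

/-- A repair scheme over `E` yields one over a subfield `L`, each symbol of `E` being sent as
`[E : L]` symbols of `L`. -/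
theorem RepairsWithErrors.restrictScalars (L : Type*) {E K ι : Type*} [Field L] [Field E]
    [Algebra L E] [Module.Finite L E] [Field K] {C : Submodule K (ι → K)} {i : ι} {R : Finset ι}
    {e : ℕ} {b : R → ℕ} {f : (j : R) → K → (Fin (b j) → E)}
    (h : RepairsWithErrors E C i R e b f) :
    ∃ f' : (j : R) → K → (Fin (b j * Module.finrank L E) → L),
      RepairsWithErrors L C i R e (fun j => b j * Module.finrank L E) f' := by
  obtain ⟨g, hg⟩ := h
  let φ : (j : R) → (Fin (b j) → E) ≃ (Fin (b j * Module.finrank L E) → L) := fun j =>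
    ((Equiv.piCongrRight fun _ => (Module.finBasis L E).equivFun.toEquiv).trans
      (Equiv.curry _ _ _).symm).trans (Equiv.arrowCongr finProdFinEquiv (Equiv.refl _))
  refine ⟨fun j x => φ j (f j x), fun y => g fun j => (φ j).symm (y j), fun c hc y hy => ?_⟩
  refine hg c hc _ (le_trans (le_of_eq ?_) hy)
  congr 1
  ext j
  simp [Equiv.symm_apply_eq]

end Bandwidth

/-! ### Row polynomials and invertibility of the repair matrices -/

section RepairMatrix

/-- `repairElement` over an arbitrary commutative ring. -/
def blockElement {A : Type*} [CommRing A] (s P : ℕ) (α β : A) (m : ℕ) : A :=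
  if m = P - 1 then ∑ u ∈ Finset.range s, β ^ u * α ^ (P - 1) else β ^ (m % s) * α ^ m

theorem repairElement_eq_blockElement {K : Type*} [Field K] (s P : ℕ) (α β : K) (m : ℕ) :
    repairElement s P α β m = blockElement s P α β m := rfl

theorem blockElement_block {A : Type*} [CommRing A] {s P : ℕ} (α β : A) {u q : ℕ}
    (hu : u < s) (h : u + q * s < P - 1) :
    blockElement s P α β (u + q * s) = β ^ u * α ^ (u + q * s) := by
  rw [blockElement, if_neg (by omega), Nat.add_mul_mod_self_right, Nat.mod_eq_of_lt hu]

theorem blockElement_last {A : Type*} [CommRing A] {s P : ℕ} (α β : A) :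
    blockElement s P α β (P - 1) = ∑ u ∈ Finset.range s, β ^ u * α ^ (P - 1) := if_pos rfl

theorem sum_range_blocks {A : Type*} [AddCommMonoid A] (φ : ℕ → A) (s N : ℕ) :
    ∑ q ∈ Finset.range N, ∑ t ∈ Finset.range s, φ (q * s + t) =
      ∑ j ∈ Finset.range (N * s), φ j := by
  induction N with
  | zero => simp
  | succ N ih => rw [Finset.sum_range_succ, ih, Nat.succ_mul, Finset.sum_range_add]

theorem sum_range_blocks_last {A : Type*} [AddCommMonoid A] (φ : ℕ → A) (s : ℕ) {N : ℕ}
    (hN : 0 < N) :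
    ∑ q ∈ Finset.range N, ∑ t ∈ Finset.range (if q + 1 = N then s + 1 else s), φ (q * s + t) =
      ∑ j ∈ Finset.range (N * s + 1), φ j := by
  obtain ⟨N, rfl⟩ : ∃ M, N = M + 1 := ⟨N - 1, by omega⟩
  rw [Finset.sum_range_succ, if_pos rfl, Nat.succ_mul, Finset.sum_range_succ φ,
    Finset.sum_range_succ _ s, Finset.sum_range_add φ, ← sum_range_blocks, ← add_assoc]
  congr 2
  refine Finset.sum_congr rfl fun q hq => ?_
  rw [if_neg (by have := Finset.mem_range.1 hq; omega)]

variable {F : Type*} [Field F]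

/-- The blocks tile the exponents `0, …, P - 1`; since `P = s N + 1`, the last block carries the one
extra term. -/
theorem sum_blockPoly_mul {A : Type*} [CommRing A] [Algebra F A] {s P N : ℕ} (hs : 0 < s)
    (hN : 0 < N) (hP : P = s * N + 1) {f : F[X]} (hf : f.Monic) (hfP : f.natDegree = P)
    (h : ℕ) (x : A) :
    ∑ q ∈ Finset.range ((P - 1) / s), aeval x (blockPoly s P f h q) * x ^ (q * s) =
      aeval x (X ^ (P + h) %ₘ f) := by
  have hdiv : (P - 1) / s = N := by
    rw [hP, Nat.add_sub_cancel, Nat.mul_div_cancel_left _ hs]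
  have hdeg : (X ^ (P + h) %ₘ f : F[X]).natDegree < N * s + 1 := by
    have := natDegree_modByMonic_lt (X ^ (P + h)) hf (by
      rintro rfl; simp at hfP; omega)
    rw [hfP] at this
    rwa [mul_comm N s, ← hP]
  rw [hdiv, aeval_eq_sum_range' hdeg, ← sum_range_blocks_last _ s hN]
  refine Finset.sum_congr rfl fun q _ => ?_
  rw [blockPoly, hdiv, map_sum, Finset.sum_mul]
  refine Finset.sum_congr rfl fun t _ => ?_
  rw [map_mul, aeval_C, map_pow, aeval_X, Algebra.smul_def, pow_add]
  ring

/-- The linear combination of `ε 0, …, ε (P-1)` with the given coefficients. -/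
def rowSum {A : Type*} [AddCommGroup A] [Module F A] (P : ℕ) (ε : ℕ → A) :
    (Fin P → F) →ₗ[F] A :=
  Fintype.linearCombination F fun t : Fin P => ε t

theorem rowSum_apply {A : Type*} [AddCommGroup A] [Module F A] (P : ℕ) (ε : ℕ → A)
    (r : Fin P → F) : rowSum P ε r = ∑ t : Fin P, r t • ε t :=
  Fintype.linearCombination_apply F _ r

theorem rowSum_unitRow {A : Type*} [AddCommGroup A] [Module F A] {P t : ℕ} (ε : ℕ → A)
    (ht : t < P) : rowSum P ε (unitRow F P t) = ε t := by
  rw [rowSum_apply, Finset.sum_eq_single ⟨t, ht⟩]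
  · simp [unitRow]
  · intro m _ hm
    rw [unitRow, if_neg (fun h => hm (Fin.ext h)), zero_smul]
  · simp

/-- The polynomial whose value at `a` is the combination of the elements `e_0, …, e_{P-1}` with
coefficients in the `m`-th row of `repairMatrix s P f a`. -/
def rowPoly {A : Type*} [CommRing A] [Algebra F A] (s P : ℕ) (f : F[X]) (α β : A) (m : ℕ) :
    A[X] :=
  if m + s + 1 < P then
    C (blockElement s P α β m) * X ^ s - C (blockElement s P α β (m + s))
  else if m + s + 1 = P then
    ∑ u ∈ Finset.range s, C (blockElement s P α β (u + (P - s - 1))) * X ^ (s - u)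
      - C (blockElement s P α β (P - 1))
  else
    ∑ u ∈ Finset.range (m + s - P + 1), ∑ q ∈ Finset.range ((P - 1) / s),
        C (blockElement s P α β (u + q * s)) *
          (blockPoly s P f (m + s - P - u) q).map (algebraMap F A)
      + ∑ u ∈ Finset.Ico (m + s - P + 1) s,
        C (blockElement s P α β (u + (P - s - 1))) * X ^ (m + s - P + 1 + s - u)
      - C (blockElement s P α β (P - 1)) * X ^ (m + s - P + 1)

theorem block_index_lt {s P N u q : ℕ} (hP : P = s * N + 1) (hu : u < s)
    (hq : q < N) : u + q * s < P - 1 := by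
  have : (q + 1) * s ≤ N * s := Nat.mul_le_mul_right _ hq
  rw [add_mul, one_mul] at this
  rw [hP, mul_comm s N]
  omega

theorem repairMatrix_row (s P : ℕ) (f : F[X]) (a : F) (m : Fin P) :
    repairMatrix s P f a m =
      if (m : ℕ) + s + 1 < P then
        a ^ s • unitRow F P m - unitRow F P (m + s)
      else if (m : ℕ) + s + 1 = P then
        ∑ u ∈ Finset.range s, a ^ (s - u) • unitRow F P (u + (P - s - 1)) - unitRow F P (P - 1)
      else
        ∑ u ∈ Finset.range (m + s - P + 1), ∑ q ∈ Finset.range ((P - 1) / s),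
            (blockPoly s P f (m + s - P - u) q).eval a • unitRow F P (u + q * s)
          + ∑ u ∈ Finset.Ico (m + s - P + 1) s,
            a ^ (m + s - P + 1 + s - u) • unitRow F P (u + (P - s - 1))
          - a ^ (m + s - P + 1) • unitRow F P (P - 1) := rfl

theorem rowSum_repairMatrix {A : Type*} [CommRing A] [Algebra F A] {s P N : ℕ} (hs : 0 < s)
    (hN : 0 < N) (hP : P = s * N + 1) (f : F[X]) (α β : A) (a : F) (m : Fin P) :
    rowSum P (blockElement s P α β) (repairMatrix s P f a m) =
      (rowPoly s P f α β m).eval (algebraMap F A a) := by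
  have hdiv : (P - 1) / s = N := by
    rw [hP, Nat.add_sub_cancel, Nat.mul_div_cancel_left _ hs]
  have hm := m.2
  have hsP : s + 1 ≤ P := by
    rw [hP]
    exact Nat.succ_le_succ (Nat.le_mul_of_pos_right s hN)
  rw [repairMatrix_row, rowPoly]
  split_ifs with h1 h2
  · rw [map_sub, map_smul, rowSum_unitRow _ hm, rowSum_unitRow _ (by omega)]
    rw [Algebra.smul_def, map_pow, mul_comm]; simp
  · rw [map_sub, map_sum, rowSum_unitRow _ (by omega), eval_sub, eval_finsetSum, eval_C]
    congr 1
    refine Finset.sum_congr rfl fun u hu => ?_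
    rw [map_smul, rowSum_unitRow _ (by have := Finset.mem_range.1 hu; omega)]
    rw [Algebra.smul_def, map_pow, mul_comm]; simp
  · rw [map_sub, map_add, map_sum, map_sum, map_smul, rowSum_unitRow _ (by omega), eval_sub,
      eval_add, eval_finsetSum, eval_finsetSum]
    congr 1
    · congr 1
      · refine Finset.sum_congr rfl fun u hu => ?_
        rw [map_sum, eval_finsetSum]
        refine Finset.sum_congr rfl fun q hq => ?_
        have hu' : u < s := by have := Finset.mem_range.1 hu; omega
        have := block_index_lt hP hu' (hdiv ▸ Finset.mem_range.1 hq)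
        rw [map_smul, rowSum_unitRow _ (by omega), eval_mul, eval_C, eval_map_algebraMap,
          aeval_algebraMap_apply_eq_algebraMap_eval, Algebra.smul_def, mul_comm]
      · refine Finset.sum_congr rfl fun u hu => ?_
        have := Finset.mem_Ico.1 hu
        rw [map_smul, rowSum_unitRow _ (by omega)]
        rw [Algebra.smul_def, map_pow, mul_comm]; simp
    · rw [Algebra.smul_def, map_pow, mul_comm]; simp

theorem rowPoly_degree_lt {A : Type*} [CommRing A] [Algebra F A] {s P : ℕ} (f : F[X])
    (α β : A) {m : ℕ} (hm : m < P) : (rowPoly s P f α β m).degree < (s + 1 : ℕ) := by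
  rw [← mem_degreeLT]
  have hX : ∀ (x : A) {t : ℕ}, t ≤ s → C x * X ^ t ∈ degreeLT A (s + 1) := fun x t ht =>
    mem_degreeLT.2 (lt_of_le_of_lt (degree_C_mul_X_pow_le t x) (by exact_mod_cast by omega))
  have hC : ∀ x : A, C x ∈ degreeLT A (s + 1) := fun x => by
    simpa using hX x (Nat.zero_le s)
  rw [rowPoly]
  split_ifs with h1 h2
  · exact Submodule.sub_mem _ (hX _ le_rfl) (hC _)
  · exact Submodule.sub_mem _ (Submodule.sum_mem _ fun u _ => hX _ (Nat.sub_le _ _)) (hC _)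
  · refine Submodule.sub_mem _ (Submodule.add_mem _ (Submodule.sum_mem _ fun u _ =>
      Submodule.sum_mem _ fun q _ => ?_) (Submodule.sum_mem _ fun u hu => hX _ ?_)) (hX _ ?_)
    · rw [← smul_eq_C_mul]
      refine Submodule.smul_mem _ _ ?_
      rw [blockPoly, Polynomial.map_sum]
      refine Submodule.sum_mem _ fun t ht => ?_
      rw [Polynomial.map_mul, map_C, Polynomial.map_pow, map_X]
      refine hX _ ?_
      have := Finset.mem_range.1 ht
      split_ifs at this <;> omega
    · have := Finset.mem_Ico.1 hu
      omega
    · omega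

theorem block_decomposition {s P N : ℕ} (hN : 0 < N) (hP : P = s * N + 1) (u : ℕ) :
    u + (P - s - 1) = u + (N - 1) * s := by
  obtain ⟨N, rfl⟩ : ∃ M, N = M + 1 := ⟨N - 1, by omega⟩
  rw [hP, Nat.add_sub_cancel, Nat.mul_succ, mul_comm s N]
  omega

/-- Multiplying by `α^s` moves `e_m` to `e_{m+s}`, and the powers `α^{s-u}` bring the last block to
the common exponent `P - 1`. Neither uses a relation on `α`, so this also holds where `f(α) ≠ 0`. -/
theorem rowPoly_eval_self_of_lt {A : Type*} [CommRing A] [Algebra F A] {s P N : ℕ} (hs : 0 < s)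
    (hN : 0 < N) (hP : P = s * N + 1) (f : F[X]) (α β : A) {m : ℕ} (hm : m + s < P) :
    (rowPoly s P f α β m).eval α = 0 := by
  have hpow : ∀ u < s, blockElement s P α β (u + (P - s - 1)) =
      β ^ u * α ^ (u + (P - s - 1)) := by
    intro u hu
    rw [block_decomposition hN hP]
    exact blockElement_block α β hu (block_index_lt hP hu (by omega))
  rw [rowPoly]
  split_ifs with h1 h2
  · rw [eval_sub, eval_mul, eval_C, eval_C, eval_pow, eval_X, blockElement, if_neg (by omega),
      blockElement, if_neg (by omega), Nat.add_mod_right, pow_add]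
    ring
  · rw [eval_sub, eval_C, blockElement_last, eval_finsetSum, sub_eq_zero]
    refine Finset.sum_congr rfl fun u hu => ?_
    have hu := Finset.mem_range.1 hu
    rw [hpow u hu, eval_mul, eval_C, eval_pow, eval_X, mul_assoc, ← pow_add]
    congr 2
    omega
  · omega

/-- The terms `u > h` cancel against those of `α^{h+1} e_{P-1}`. For `u ≤ h` there remains `β^u α^u`
times the difference of `X^{P+h-u} mod f` and `X^{P+h-u}` at `α`, a multiple of `f(α)`. It vanishes
at a root of `f`; elsewhere it drives the invertibility proof. -/
theorem rowPoly_eval_self {A : Type*} [CommRing A] [Algebra F A] {s P N : ℕ} (hs : 0 < s)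
    (hN : 0 < N) (hP : P = s * N + 1) {f : F[X]} (hf : f.Monic) (hfP : f.natDegree = P)
    (α β : A) {h : ℕ} (hh : h < s) :
    (rowPoly s P f α β (P - s + h)).eval α =
      - ∑ u ∈ Finset.range (h + 1), β ^ u * α ^ u *
        (aeval α f * aeval α (X ^ (P + (h - u)) /ₘ f)) := by
  have hdiv : (P - 1) / s = N := by
    rw [hP, Nat.add_sub_cancel, Nat.mul_div_cancel_left _ hs]
  have hsP : s + 1 ≤ P := by
    rw [hP]
    exact Nat.succ_le_succ (Nat.le_mul_of_pos_right s hN)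
  rw [rowPoly, if_neg (by omega), if_neg (by omega), show P - s + h + s - P = h by omega,
    eval_sub, eval_add, eval_finsetSum, eval_finsetSum, eval_mul, eval_C, eval_pow, eval_X,
    blockElement_last, Finset.sum_mul,
    ← Finset.sum_range_add_sum_Ico (fun u => β ^ u * α ^ (P - 1) * α ^ (h + 1))
      (show h + 1 ≤ s by omega)]
  have h2 : ∑ u ∈ Finset.Ico (h + 1) s,
      (C (blockElement s P α β (u + (P - s - 1))) * X ^ (h + 1 + s - u)).eval α =
      ∑ u ∈ Finset.Ico (h + 1) s, β ^ u * α ^ (P - 1) * α ^ (h + 1) := by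
    refine Finset.sum_congr rfl fun u hu => ?_
    have hu := Finset.mem_Ico.1 hu
    rw [block_decomposition hN hP, blockElement_block α β hu.2
      (block_index_lt hP hu.2 (by omega)), ← block_decomposition hN hP, eval_mul, eval_C,
      eval_pow, eval_X, mul_assoc, mul_assoc, ← pow_add, ← pow_add]
    congr 2
    omega
  rw [h2, add_sub_add_right_eq_sub, ← Finset.sum_sub_distrib, ← Finset.sum_neg_distrib]
  refine Finset.sum_congr rfl fun u hu => ?_
  have hu := Finset.mem_range.1 hu
  have h3 : ((∑ q ∈ Finset.range ((P - 1) / s), C (blockElement s P α β (u + q * s)) *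
      (blockPoly s P f (h - u) q).map (algebraMap F A)).eval α) =
      β ^ u * α ^ u * aeval α (X ^ (P + (h - u)) %ₘ f) := by
    rw [← sum_blockPoly_mul hs hN hP hf hfP, eval_finsetSum, Finset.mul_sum]
    refine Finset.sum_congr rfl fun q hq => ?_
    rw [blockElement_block α β (by omega)
      (block_index_lt hP (by omega) (hdiv ▸ Finset.mem_range.1 hq)), eval_mul, eval_C,
      eval_map_algebraMap, pow_add]
    ring
  have h4 : aeval α (X ^ (P + (h - u)) %ₘ f) + aeval α f * aeval α (X ^ (P + (h - u)) /ₘ f) =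
      α ^ (P + (h - u)) := by
    rw [← map_mul, ← map_add, modByMonic_add_div _ f, map_pow, aeval_X]
  rw [h3, eq_sub_of_add_eq h4, mul_assoc (β ^ u) (α ^ (P - 1)), ← pow_add,
    show P - 1 + (h + 1) = u + (P + (h - u)) by omega, pow_add α u]
  ring

theorem repairMatrix_apply_of_lt {s P : ℕ} (f : F[X]) (a : F) {m : Fin P}
    (h : (m : ℕ) + s + 1 < P) (t : Fin P) :
    repairMatrix s P f a m t =
      (if t = m then a ^ s else 0) - if (t : ℕ) = m + s then 1 else 0 := by
  simp [repairMatrix, h, unitRow, Fin.ext_iff]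

theorem repairMatrix_apply_last {s P : ℕ} (f : F[X]) (a : F) {m t : Fin P}
    (h : (m : ℕ) + s + 1 = P) (ht : (t : ℕ) = P - 1) : repairMatrix s P f a m t = -1 := by
  have h1 : ¬ (m : ℕ) + s + 1 < P := by omega
  simp only [repairMatrix, Matrix.of_apply, if_neg h1, if_pos h, Pi.sub_apply,
    Finset.sum_apply, Pi.smul_apply]
  rw [Finset.sum_eq_zero, unitRow, if_pos ht, zero_sub]
  intro u hu
  have := Finset.mem_range.1 hu
  rw [unitRow, if_neg (by omega), smul_zero]

/-- With `β` an indeterminate the value is a polynomial in `β` whose coefficients stop at `β^h`;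
this is the triangular shape of the last `s` rows. -/
theorem coeff_rowPoly_eval_self {s P N : ℕ} (hs : 0 < s) (hN : 0 < N) (hP : P = s * N + 1)
    {f : F[X]} (hf : f.Monic) (hfP : f.natDegree = P) (a : F) {h : ℕ} (hh : h < s) (j : ℕ) :
    ((rowPoly (A := F[X]) s P f (C a) X (P - s + h)).eval (C a)).coeff j =
      - if j < h + 1 then a ^ j * (f.eval a * (X ^ (P + (h - j)) /ₘ f).eval a) else 0 := by
  have hC : ∀ g : F[X], aeval (C a) g = C (g.eval a) := fun g =>
    aeval_algebraMap_apply_eq_algebraMap_eval a g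
  rw [rowPoly_eval_self hs hN hP hf hfP _ _ hh, coeff_neg, finsetSum_coeff]
  congr 1
  have h1 : ∀ u, (X ^ u * C a ^ u * (aeval (C a) f * aeval (C a) (X ^ (P + (h - u)) /ₘ f)) :
      F[X]).coeff j =
      if j = u then a ^ u * (f.eval a * (X ^ (P + (h - u)) /ₘ f).eval a) else 0 := by
    intro u
    rw [hC, hC, ← C_pow, ← C_mul, mul_assoc, ← C_mul, mul_comm, coeff_C_mul_X_pow]
  simp only [h1]
  rw [Finset.sum_ite_eq]
  simp only [Finset.mem_range]

theorem X_pow_natDegree_divByMonic {f : F[X]} (hf : f.Monic) : X ^ f.natDegree /ₘ f = 1 := by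
  have h1 : (X ^ f.natDegree /ₘ f).natDegree = 0 := by
    rw [natDegree_divByMonic _ hf, natDegree_X_pow, Nat.sub_self]
  refine (Monic.natDegree_eq_zero ?_).1 h1
  rw [Monic, leadingCoeff_divByMonic_of_monic hf, leadingCoeff_X_pow]
  rw [degree_X_pow, degree_eq_natDegree hf.ne_zero]

theorem vecMul_repairMatrix_eq_zero {s P N : ℕ} (hs : 0 < s) (hN : 0 < N) (hP : P = s * N + 1)
    {f : F[X]} (hf : f.Monic) (hfP : f.natDegree = P) {a : F} (ha : a ≠ 0)
    (hfa : f.eval a ≠ 0) {c : Fin P → F} (hc : Matrix.vecMul c (repairMatrix s P f a) = 0) :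
    c = 0 := by
  have hsP : s + 1 ≤ P := by
    rw [hP]
    exact Nat.succ_le_succ (Nat.le_mul_of_pos_right s hN)
  -- Pair the vanishing row combination with the formal elements `e_t`, taking `α = a` and `β = X`.
  have hsum : ∑ m : Fin P, c m • (rowPoly (A := F[X]) s P f (C a) X m).eval (C a) = 0 := by
    have h := congrArg (rowSum P (blockElement s P (C a) (X : F[X]))) hc
    rw [map_zero, Matrix.vecMul_eq_sum, map_sum] at h
    rw [← h]
    refine Finset.sum_congr rfl fun m _ => ?_
    rw [map_smul, rowSum_repairMatrix hs hN hP]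
    rfl
  -- Descending induction on `h`, with `j = s - 1 - h`: once the rows above `h` are gone, only row
  -- `P - s + h` contributes to the coefficient of `X^h`, namely `-a^h f(a)`.
  have hhigh : ∀ j h : ℕ, h + j + 1 = s → ∀ m : Fin P, (m : ℕ) = P - s + h → c m = 0 := by
    intro j
    induction j using Nat.strong_induction_on with
    | _ j ih =>
      intro h hj m hm
      have hco := congrArg (fun g : F[X] => g.coeff h) hsum
      simp only [finsetSum_coeff, coeff_smul, coeff_zero] at hco
      rw [Finset.sum_eq_single m ?_ (by simp), hm,
        coeff_rowPoly_eval_self hs hN hP hf hfP _ (by omega), if_pos (by omega), Nat.sub_self,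
        add_zero, ← hfP, X_pow_natDegree_divByMonic hf, eval_one, mul_one, smul_neg,
        neg_eq_zero, smul_eq_mul] at hco
      · exact (mul_eq_zero.1 hco).resolve_right (mul_ne_zero (pow_ne_zero _ ha) hfa)
      · intro m' _ hm'
        have hne : (m' : ℕ) ≠ m := fun h => hm' (Fin.ext h)
        have hlt := m'.2
        rcases lt_or_ge ((m' : ℕ) + s) P with h1 | h1
        · rw [rowPoly_eval_self_of_lt hs hN hP f _ _ h1, coeff_zero, smul_zero]
        · obtain ⟨h', hh'⟩ : ∃ h', (m' : ℕ) = P - s + h' := ⟨m' - (P - s), by omega⟩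
          rcases lt_or_ge h h' with h2 | h2
          · rw [ih (s - 1 - h') (by omega) h' (by omega) m' hh', zero_smul]
          · rw [hh', coeff_rowPoly_eval_self hs hN hP hf hfP _ (by omega), if_neg (by omega),
              neg_zero, smul_zero]
  have hhigh' : ∀ m : Fin P, P ≤ (m : ℕ) + s → c m = 0 := fun m hm =>
    hhigh (P - 1 - m) (m + s - P) (by omega) m (by omega)
  have hcoord : ∀ t, ∑ m, c m * repairMatrix s P f a m t = 0 := fun t => congrFun hc t
  -- Among the surviving rows only row `P - s - 1` meets the last column.
  have hmid : ∀ m : Fin P, (m : ℕ) + s + 1 = P → c m = 0 := by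
    intro m hm
    have h := hcoord ⟨P - 1, by omega⟩
    rw [Finset.sum_eq_single m ?_ (by simp), repairMatrix_apply_last f a hm rfl] at h
    · simpa using h
    · intro m' _ hm'
      have hne : (m' : ℕ) ≠ m := fun h => hm' (Fin.ext h)
      rcases lt_or_ge ((m' : ℕ) + s) P with h1 | h1
      · rw [repairMatrix_apply_of_lt f a (by omega), if_neg (by rw [Fin.ext_iff]; simp; omega),
          if_neg (by simp; omega), sub_zero, mul_zero]
      · rw [hhigh' m' h1, zero_mul]
  -- The rows left are upper triangular with diagonal `a^s`: column `m` meets only rows `m` and `m -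
  -- s`.
  have hlow : ∀ j : ℕ, ∀ m : Fin P, (m : ℕ) = j → j + s + 1 < P → c m = 0 := by
    intro j
    induction j using Nat.strong_induction_on with
    | _ j ih =>
      intro m hmj hj
      have h := hcoord m
      rw [Finset.sum_eq_single m ?_ (by simp), repairMatrix_apply_of_lt f a (by omega),
        if_pos rfl, if_neg (by omega), sub_zero] at h
      · exact (mul_eq_zero.1 h).resolve_right (pow_ne_zero _ ha)
      · intro m' _ hm'
        have hne : (m' : ℕ) ≠ m := fun h => hm' (Fin.ext h)
        rcases lt_trichotomy ((m' : ℕ) + s + 1) P with h1 | h1 | h1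
        · by_cases h2 : (m : ℕ) = m' + s
          · rw [ih m' (by omega) m' rfl h1, zero_mul]
          · rw [repairMatrix_apply_of_lt f a h1, if_neg (Ne.symm hm'), if_neg h2, sub_zero,
              mul_zero]
        · rw [hmid m' h1, zero_mul]
        · rw [hhigh' m' (by omega), zero_mul]
  funext m
  rcases lt_trichotomy ((m : ℕ) + s + 1) P with h1 | h1 | h1
  · exact hlow m m rfl h1
  · exact hmid m h1
  · exact hhigh' m (by omega)

theorem isUnit_repairMatrix {s P N : ℕ} (hs : 0 < s) (hN : 0 < N) (hP : P = s * N + 1)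
    {f : F[X]} (hf : f.Monic) (hfP : f.natDegree = P) {a : F} (ha : a ≠ 0)
    (hfa : f.eval a ≠ 0) : IsUnit (repairMatrix s P f a) := by
  rw [← Matrix.vecMul_injective_iff_isUnit]
  intro c c' hcc
  rw [← sub_eq_zero]
  refine vecMul_repairMatrix_eq_zero hs hN hP hf hfP ha hfa ?_
  rw [Matrix.sub_vecMul]
  exact sub_eq_zero.2 hcc

end RepairMatrix

/-! ### Spanning by the repair elements, and the trace form -/

section Span

variable {F K : Type*} [Field F] [Field K] [Algebra F K]

theorem exists_aeval_eq_of_mem_adjoin_simple {x y : K} (hx : IsIntegral F x)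
    (hy : y ∈ IntermediateField.adjoin F {x}) :
    ∃ g : F[X], g.natDegree < (minpoly F x).natDegree ∧ aeval x g = y := by
  rw [← IntermediateField.mem_toSubalgebra,
    IntermediateField.adjoin_simple_toSubalgebra_of_isAlgebraic hx.isAlgebraic,
    Algebra.adjoin_singleton_eq_range_aeval] at hy
  obtain ⟨g, rfl⟩ := hy
  refine ⟨g %ₘ minpoly F x, natDegree_modByMonic_lt _ (minpoly.monic hx) (minpoly.ne_one F x), ?_⟩
  exact (aeval_modByMonic_eq_self_of_root (minpoly.aeval F x))

/-- As `α ≠ 0`, any `deg α` consecutive powers of `α` span `F(α)`: expand `α^t / α^r` in the power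
basis. -/
theorem mul_pow_mem_of_consecutive {α y : K} (hα : IsIntegral F α) (hα0 : α ≠ 0)
    {W : Submodule F K} {r : ℕ}
    (h : ∀ t < (minpoly F α).natDegree, y * α ^ (r + t) ∈ W) (t : ℕ) : y * α ^ t ∈ W := by
  obtain ⟨g, hg, hgt⟩ := exists_aeval_eq_of_mem_adjoin_simple (F := F) (y := α ^ t / α ^ r) hα
    (div_mem (pow_mem (IntermediateField.mem_adjoin_simple_self F α) _)
      (pow_mem (IntermediateField.mem_adjoin_simple_self F α) _))
  rw [aeval_eq_sum_range' hg, eq_div_iff (pow_ne_zero _ hα0)] at hgt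
  rw [← hgt, Finset.sum_mul, Finset.mul_sum]
  refine Submodule.sum_mem _ fun u hu => ?_
  have := W.smul_mem (g.coeff u) (h u (Finset.mem_range.1 hu))
  rwa [show y * (g.coeff u • α ^ u * α ^ r) = g.coeff u • (y * α ^ (r + u)) by
    rw [smul_mul_assoc, mul_smul_comm, pow_add, mul_comm (α ^ r)]]

/-- The products `e_m α^t`, `t < s`, span the field. -/
theorem eq_top_of_repairElement_mul_pow_mem {s P N : ℕ} (hN : 0 < N) (hP : P = s * N + 1)
    {α β : K} (hα : IsIntegral F α) (hα0 : α ≠ 0) (hαP : (minpoly F α).natDegree = P)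
    (hspan : ∀ W : Submodule F K, (∀ u < s, ∀ t < P, β ^ u * α ^ t ∈ W) → W = ⊤)
    {W : Submodule F K} (hW : ∀ m < P, ∀ t < s, repairElement s P α β m * α ^ t ∈ W) :
    W = ⊤ := by
  refine hspan W ?_
  have hsP : s + 1 ≤ P := by
    rw [hP]
    exact Nat.succ_le_succ (Nat.le_mul_of_pos_right s hN)
  -- The elements `e_{u+qs} α^t` yield `P - 1` consecutive powers for each `u`, one short of a basis
  -- of `F(α)`.
  have hbase : ∀ u < s, ∀ t, u ≤ t → t < u + (P - 1) → β ^ u * α ^ t ∈ W := by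
    intro u hu t hut ht
    have hq : u + (t - u) / s * s < P - 1 := by
      refine block_index_lt hP hu ?_
      rw [Nat.div_lt_iff_lt_mul (by omega), mul_comm N s]
      omega
    have h := hW (u + (t - u) / s * s) (by omega) ((t - u) % s) (Nat.mod_lt _ (by omega))
    rw [repairElement_eq_blockElement, blockElement_block _ _ hu hq, mul_assoc, ← pow_add] at h
    have hmod := Nat.div_add_mod' (t - u) s
    rwa [show u + (t - u) / s * s + (t - u) % s = t by omega] at h
  have hall : ∀ u < s, ∀ t, β ^ u * α ^ t ∈ W := by
    intro u
    induction u using Nat.strong_induction_on with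
    | _ u ih =>
      intro hu
      refine mul_pow_mem_of_consecutive (r := u) hα hα0 fun t ht => ?_
      rcases lt_or_ge t (P - 1) with h1 | h1
      · exact hbase u hu _ (by omega) (by omega)
      -- The missing exponent `P - 1 + u` comes from `e_{P-1} α^u`: its terms with `w < u` are in
      -- `W` by induction, those with `w > u` by `hbase`.
      · have h := hW (P - 1) (by omega) u hu
        rw [repairElement_eq_blockElement, blockElement_last, Finset.sum_mul,
          ← Finset.add_sum_erase _ _ (Finset.mem_range.2 hu), mul_assoc, ← pow_add] at h
        rw [show u + t = P - 1 + u by omega]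
        refine (W.add_mem_iff_left (Submodule.sum_mem _ fun w hw => ?_)).1 h
        rw [Finset.mem_erase, Finset.mem_range] at hw
        rw [mul_assoc, ← pow_add]
        rcases lt_or_gt_of_ne hw.1 with h2 | h2
        · exact ih w h2 hw.2 _
        · exact hbase w hw.2 _ (by omega) (by omega)
  exact fun u hu t _ => hall u hu t

theorem eq_zero_of_trace_repairElement [FiniteDimensional F K] [Algebra.IsSeparable F K]
    {s P N : ℕ} (hN : 0 < N) (hP : P = s * N + 1)
    {α β : K} (hα0 : α ≠ 0) (hαP : (minpoly F α).natDegree = P)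
    (hspan : ∀ W : Submodule F K, (∀ u < s, ∀ t < P, β ^ u * α ^ t ∈ W) → W = ⊤) {y : K}
    (hy : ∀ m < P, ∀ t < s, Algebra.trace F K (repairElement s P α β m * α ^ t * y) = 0) :
    y = 0 := by
  have h := eq_top_of_repairElement_mul_pow_mem hN hP (.of_finite F α) hα0 hαP hspan
    (W := LinearMap.ker ((Algebra.trace F K).comp (LinearMap.mulRight F y))) fun m hm t ht => by
      simpa using hy m hm t ht
  refine (traceForm_nondegenerate F K).2 y fun x => ?_
  have hx : x ∈ LinearMap.ker ((Algebra.trace F K).comp (LinearMap.mulRight F y)) :=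
    by rw [h]; exact Submodule.mem_top
  simpa [Algebra.traceForm_apply] using hx

end Span

/-! ### Parity checks, the code containing the transformed data, and recovery -/

section Repair

variable {F K : Type*} [Field F] [Field K] [Algebra F K]

theorem repairMatrix_mulVec_traceVector {s P N : ℕ} (hs : 0 < s)
    (hN : 0 < N) (hP : P = s * N + 1) (f : F[X]) (α β v x : K) (a : F) (m : Fin P) :
    (repairMatrix s P f a).mulVec (traceVector F s P α β v x) m =
      Algebra.trace F K ((rowPoly s P f α β m).eval (algebraMap F K a) * v * x) := by
  rw [← rowSum_repairMatrix hs hN hP, rowSum_apply, Finset.sum_mul, Finset.sum_mul, map_sum]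
  change ∑ t, repairMatrix s P f a m t * traceVector F s P α β v x t = _
  refine Finset.sum_congr rfl fun t _ => ?_
  rw [smul_mul_assoc, smul_mul_assoc, map_smul]
  rfl

theorem traceVector_sub (s P : ℕ) (α β v x x' : K) :
    traceVector F s P α β v (x - x') =
      traceVector F s P α β v x - traceVector F s P α β v x' := by
  funext m
  simp [traceVector, mul_sub]

variable {n k : ℕ} {α v : Fin n → K}

theorem sum_mul_eval_mul_eq_zero (hdual : dualCode (rsCode k α) = grsCode (n - k) v α)
    {c : Fin n → K} (hc : c ∈ rsCode k α) {g : K[X]} (hg : g.degree < (n - k : ℕ)) :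
    ∑ j, g.eval (α j) * v j * c j = 0 := by
  have h : (fun j => v j * g.eval (α j)) ∈ dualCode (rsCode k α) := by
    rw [hdual]
    exact ⟨g, hg, fun _ => rfl⟩
  simpa [mul_comm] using h c hc

variable {i : Fin n} {a : {j : Fin n // j ≠ i} → F}

/-- Row polynomials vanish at `α_i`, so their multiples over `F` of degree below `n - k` are parity
checks on the other nodes alone. Membership is tested in the dual description, with `n - 1 - (n - k
- s) = s + k - 1`. -/
theorem mulVec_traceVector_mem_grsCode {s P N : ℕ} (hs : 0 < s) (hN : 0 < N)
    (hP : P = s * N + 1) (hαP : (minpoly F (α i)).natDegree = P) (hsn : s + k ≤ n)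
    (ha : ∀ j, algebraMap F K (a j) = α j) (hainj : Function.Injective a) (β : K)
    (hdual : dualCode (rsCode k α) = grsCode (n - k) v α)
    {c : Fin n → K} (hc : c ∈ rsCode k α) (m : Fin P) :
    (fun j : {j : Fin n // j ≠ i} => (repairMatrix s P (minpoly F (α i)) (a j)).mulVec
      (traceVector F s P (α i) β (v j) (c j)) m) ∈
      grsCode (s + k - 1) (Lagrange.nodalWeight Finset.univ a) a := by
  have hcard : Fintype.card {j : Fin n // j ≠ i} = n - 1 := by
    simp [Fintype.card_subtype_compl]
  have h := dualCode_rsCode hainj (m := n - k - s) (by rw [hcard]; omega)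
  have hn : 0 < n := i.pos
  have hf : (minpoly F (α i)).Monic := minpoly.monic (by
    by_contra hcon
    rw [minpoly.eq_zero hcon, natDegree_zero] at hαP
    omega)
  rw [hcard, show n - 1 - (n - k - s) = s + k - 1 by omega] at h
  rw [← h, mem_dualCode_rsCode_iff]
  intro H hH
  have hroot : (rowPoly s P (minpoly F (α i)) (α i) β m).eval (α i) = 0 := by
    rcases lt_or_ge ((m : ℕ) + s) P with h1 | h1
    · exact rowPoly_eval_self_of_lt hs hN hP _ _ _ h1
    · have hsP : s + 1 ≤ P := by
        rw [hP]
        exact Nat.succ_le_succ (Nat.le_mul_of_pos_right s hN)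
      have hm := m.2
      obtain ⟨h', hh'⟩ : ∃ h', (m : ℕ) = P - s + h' := ⟨m - (P - s), by omega⟩
      rw [hh', rowPoly_eval_self hs hN hP hf hαP _ _ (by omega)]
      simp [minpoly.aeval]
  have hdeg : (rowPoly s P (minpoly F (α i)) (α i) β m * H.map (algebraMap F K)).degree <
      (n - k : ℕ) := by
    rcases eq_or_ne H 0 with rfl | hH0
    · simp
    rcases eq_or_ne (rowPoly s P (minpoly F (α i)) (α i) β m) 0 with h0 | h0
    · simp [h0]
    have hr := rowPoly_degree_lt (s := s) (minpoly F (α i)) (α i) β m.2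
    rw [degree_mul, degree_map]
    rw [degree_eq_natDegree hH0] at hH ⊢
    rw [degree_eq_natDegree h0] at hr ⊢
    norm_cast at hH hr ⊢
    omega
  have hsum := congrArg (Algebra.trace F K) (sum_mul_eval_mul_eq_zero hdual hc hdeg)
  rw [Fintype.sum_eq_add_sum_subtype_ne _ i, eval_mul, hroot, zero_mul, zero_mul, zero_mul,
    zero_add, map_sum, map_zero] at hsum
  rw [← hsum]
  refine Finset.sum_congr rfl fun j _ => ?_
  rw [repairMatrix_mulVec_traceVector hs hN hP, ha, eval_mul, ← ha, eval_map_algebraMap,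
    aeval_algebraMap_apply_eq_algebraMap_eval, mul_comm _ (H.eval _), ← smul_eq_mul, ← map_smul,
    Algebra.smul_def]
  congr 1
  ring

/-- A codeword whose helper data vanish at all surviving nodes vanishes at the failed node. -/
theorem apply_eq_zero_of_traceVector_eq_zero [FiniteDimensional F K] [Algebra.IsSeparable F K]
    {s P N : ℕ} (hN : 0 < N) (hP : P = s * N + 1)
    (hαP : (minpoly F (α i)).natDegree = P) (hα0 : α i ≠ 0) (hsn : s + k ≤ n)
    (ha : ∀ j, algebraMap F K (a j) = α j) {β : K}
    (hspan : ∀ W : Submodule F K, (∀ u < s, ∀ t < P, β ^ u * α i ^ t ∈ W) → W = ⊤)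
    (hv : v i ≠ 0) (hdual : dualCode (rsCode k α) = grsCode (n - k) v α)
    {c : Fin n → K} (hc : c ∈ rsCode k α)
    (h0 : ∀ j : {j : Fin n // j ≠ i}, traceVector F s P (α i) β (v j) (c j) = 0) :
    c i = 0 := by
  refine (mul_eq_zero.1 (?_ : v i * c i = 0)).resolve_left hv
  refine eq_zero_of_trace_repairElement hN hP hα0 hαP hspan fun m hm t ht => ?_
  have hsum := congrArg (Algebra.trace F K) (sum_mul_eval_mul_eq_zero hdual hc
    (g := C (repairElement s P (α i) β m) * X ^ t)
    (lt_of_le_of_lt (degree_C_mul_X_pow_le t _) (by norm_cast; omega)))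
  rw [Fintype.sum_eq_add_sum_subtype_ne _ i, map_add, map_sum, Finset.sum_eq_zero, add_zero,
    map_zero, eval_mul, eval_C, eval_pow, eval_X, mul_assoc _ (v i)] at hsum
  · exact hsum
  · intro j _
    have hj := congrFun (h0 j) ⟨m, hm⟩
    simp only [traceVector, Pi.zero_apply] at hj
    rw [eval_mul, eval_C, eval_pow, eval_X, ← ha, ← map_pow, mul_right_comm _ _ (v j),
      mul_right_comm _ _ (c j), mul_comm, ← Algebra.smul_def, map_smul, hj, smul_zero]

/-- Repair of node `i` from any `d = s + k - 1 + 2e` helpers, `e` of which may be erroneous. -/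
theorem repairsWithErrors_traceVector [FiniteDimensional F K] [Algebra.IsSeparable F K]
    {s P N e : ℕ} (hs : 0 < s) (hN : 0 < N) (hP : P = s * N + 1)
    (hαP : (minpoly F (α i)).natDegree = P) (hsn : s + k ≤ n)
    (hinj : Function.Injective α) (hα0 : ∀ j, α j ≠ 0)
    (ha : ∀ j, algebraMap F K (a j) = α j)
    (hfa : ∀ j, (minpoly F (α i)).eval (a j) ≠ 0) {β : K}
    (hspan : ∀ W : Submodule F K, (∀ u < s, ∀ t < P, β ^ u * α i ^ t ∈ W) → W = ⊤)
    (hv : v i ≠ 0) (hdual : dualCode (rsCode k α) = grsCode (n - k) v α)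
    {R : Finset (Fin n)} (hi : i ∉ R) (hR : R.card + 1 = s + k + 2 * e) :
    RepairsWithErrors F (rsCode k α) i R e (fun _ => P)
      (fun j x => traceVector F s P (α i) β (v j) x) := by
  have hainj : Function.Injective a := fun j j' h =>
    Subtype.ext (hinj (by rw [← ha, ← ha, h]))
  refine repairsWithErrors_of_apply_eq fun c hc c' hc' hcc => ?_
  have hδ : c - c' ∈ rsCode k α := Submodule.sub_mem _ hc hc'
  rw [← sub_eq_zero, ← Pi.sub_apply]
  refine apply_eq_zero_of_traceVector_eq_zero hN hP hαP (hα0 i) hsn ha hspan hv hdual hδ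
    fun j => ?_
  have hunit := isUnit_repairMatrix hs hN hP (minpoly.monic (.of_finite F (α i))) hαP
    (a := a j) (fun h => hα0 j (by rw [← ha, h, map_zero])) (hfa j)
  refine Matrix.mulVec_injective_iff_isUnit.2 hunit ?_
  rw [Matrix.mulVec_zero]
  funext m
  obtain ⟨g, hg, hgz⟩ := mulVec_traceVector_mem_grsCode hs hN hP hαP hsn ha hainj β hdual hδ m
  have hw : ∀ j, Lagrange.nodalWeight Finset.univ a j ≠ 0 := fun j =>
    Lagrange.nodalWeight_ne_zero hainj.injOn (Finset.mem_univ j)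
  suffices hg0 : g.map (algebraMap F K) = 0 by
    rw [Polynomial.map_eq_zero] at hg0
    have := hgz j
    simpa [hg0] using this
  -- The zeros are counted on `R` only, but `g = 0` clears the data of every `j ≠ i`, helper or not.
  refine eq_zero_of_ncard_eval_ne_zero_le (a := α) (m := s + k - 1) (t := 2 * e)
    (by rwa [degree_map]) R hinj.injOn (by omega)
    (le_trans (Set.ncard_le_ncard ?_ (Set.toFinite _)) hcc)
  intro j hj hjj
  refine hj ?_
  have hji : (j : Fin n) ≠ i := fun h => hi (h ▸ j.2)
  have hz := hgz ⟨j, hji⟩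
  simp only [Pi.sub_apply, traceVector_sub] at hz
  rw [hjj, sub_self, Matrix.mulVec_zero, Pi.zero_apply, eq_comm, mul_eq_zero] at hz
  have := hz.resolve_left (hw _)
  rw [← ha ⟨j, hji⟩, eval_map_algebraMap, aeval_algebraMap_apply_eq_algebraMap_eval, this, map_zero]

end Repair

/-! ### Degrees in composita of fields of coprime degrees -/

section Fields

variable {L K ι : Type*} [Field L] [Field K] [Algebra L K]

theorem isIntegral_of_natDegree_minpoly_ne_zero {x : K} (h : (minpoly L x).natDegree ≠ 0) :
    IsIntegral L x := by
  by_contra hx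
  exact h (by rw [minpoly.eq_zero hx, natDegree_zero])

/-- Elements of pairwise coprime degrees generate a field of degree the product of the degrees. -/
theorem finrank_adjoin_image_of_coprime {α : ι → K} {P : ι → ℕ}
    (hα : ∀ i, (minpoly L (α i)).natDegree = P i) (hP0 : ∀ i, P i ≠ 0)
    (hP : Pairwise fun i j => (P i).Coprime (P j)) (S : Finset ι) :
    Module.finrank L (IntermediateField.adjoin L (α '' S)) = ∏ j ∈ S, P j := by
  classical
  induction S using Finset.induction_on with
  | empty => simp
  | insert i S hi ih =>
    have hint : IsIntegral L (α i) :=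
      isIntegral_of_natDegree_minpoly_ne_zero ((hα i).trans_ne (hP0 i))
    have hfin : Module.finrank L (IntermediateField.adjoin L {α i}) = P i := by
      rw [IntermediateField.adjoin.finrank hint, hα]
    rw [Finset.prod_insert hi, Finset.coe_insert, Set.image_insert_eq, Set.insert_eq,
      IntermediateField.adjoin_union, IntermediateField.LinearDisjoint.finrank_sup, ih, hfin]
    refine IntermediateField.LinearDisjoint.of_finrank_coprime ?_
    rw [ih, hfin]
    refine Nat.Coprime.prod_right fun j hj => hP ?_
    rintro rfl
    exact hi hj

theorem ne_zero_of_two_le_natDegree_minpoly {x : K} (h : 2 ≤ (minpoly L x).natDegree) :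
    x ≠ 0 := by
  rintro rfl
  rw [minpoly.zero, natDegree_X] at h
  omega

/-- An irreducible polynomial with a root in the base field is linear. -/
theorem eval_minpoly_ne_zero {x : K} (h : 2 ≤ (minpoly L x).natDegree) (a : L) :
    (minpoly L x).eval a ≠ 0 := by
  intro ha
  have hint : IsIntegral L x := isIntegral_of_natDegree_minpoly_ne_zero (by omega)
  have h1 := natDegree_eq_of_degree_eq_some (n := 1)
    (degree_eq_one_of_irreducible_of_root (minpoly.irreducible hint) ha)
  omega

end Fields

/-! ### The tower of the prime field, the repair field, the point field and `K` -/

section PointField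

variable {p n s : ℕ} [Fact p.Prime] {P : Fin n → ℕ} {K : Type*} [Field K] [Algebra (ZMod p) K]
  {α : Fin n → K} {β : K}

theorem finrank_pointField (hα : ∀ i, (minpoly (ZMod p) (α i)).natDegree = P i)
    (hP0 : ∀ i, P i ≠ 0) (hP : Pairwise fun i j => (P i).Coprime (P j)) :
    Module.finrank (ZMod p) (pointField p α) = ∏ j, P j := by
  have h := finrank_adjoin_image_of_coprime hα hP0 hP Finset.univ
  rwa [Finset.coe_univ, Set.image_univ] at h

theorem finrank_repairField (hα : ∀ i, (minpoly (ZMod p) (α i)).natDegree = P i)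
    (hP0 : ∀ i, P i ≠ 0) (hP : Pairwise fun i j => (P i).Coprime (P j)) (i : Fin n) :
    Module.finrank (ZMod p) (repairField p α i) = ∏ j ∈ Finset.univ.erase i, P j := by
  have h := finrank_adjoin_image_of_coprime hα hP0 hP (Finset.univ.erase i)
  rwa [show ((Finset.univ.erase i : Finset (Fin n)) : Set (Fin n)) = {j | j ≠ i} by
    ext j; simp] at h

theorem finrank_pointField_top (hs : 0 < s)
    (hβ : (minpoly (pointField p α) β).natDegree = s)
    (hK : IntermediateField.adjoin (pointField p α) {β} = ⊤) :
    Module.finrank (pointField p α) K = s := by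
  have hint : IsIntegral (pointField p α) β :=
    isIntegral_of_natDegree_minpoly_ne_zero (by omega)
  rw [← IntermediateField.finrank_top', ← hK, IntermediateField.adjoin.finrank hint, hβ]

theorem restrictScalars_adjoin_repairField (i : Fin n) :
    (IntermediateField.adjoin (repairField p α i) {α i}).restrictScalars (ZMod p) =
      pointField p α := by
  rw [IntermediateField.adjoin_adjoin_left]
  congr 1
  ext x
  constructor
  · rintro (⟨j, _, rfl⟩ | rfl) <;> exact Set.mem_range_self _
  · rintro ⟨j, rfl⟩
    by_cases h : j = i
    · exact Or.inr (by rw [h]; rfl)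
    · exact Or.inl ⟨j, h, rfl⟩

/-- Adjoining `α_i` to the repair field gives the point field, so the degree is the quotient of the
two products of the `P j`. -/
theorem natDegree_minpoly_repairField (hα : ∀ i, (minpoly (ZMod p) (α i)).natDegree = P i)
    (hP0 : ∀ i, P i ≠ 0) (hP : Pairwise fun i j => (P i).Coprime (P j)) (i : Fin n) :
    (minpoly (repairField p α i) (α i)).natDegree = P i := by
  have h1 : Module.finrank (ZMod p)
      ((IntermediateField.adjoin (repairField p α i) {α i}).restrictScalars (ZMod p)) =
      ∏ j, P j := by
    rw [restrictScalars_adjoin_repairField, finrank_pointField hα hP0 hP]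
  have h2 : Module.finrank (ZMod p) (repairField p α i) *
      Module.finrank (repairField p α i) (IntermediateField.adjoin (repairField p α i) {α i}) =
      ∏ j, P j := by
    rw [← h1]
    exact Module.finrank_mul_finrank (ZMod p) (repairField p α i)
      (IntermediateField.adjoin (repairField p α i) {α i})
  rw [IntermediateField.adjoin.finrank (isIntegral_of_natDegree_minpoly_ne_zero ((hα i).trans_ne (hP0 i))).tower_top,
    finrank_repairField hα hP0 hP, ← Finset.prod_erase_mul _ _ (Finset.mem_univ i)] at h2
  exact Nat.eq_of_mul_eq_mul_left
    (Nat.pos_of_ne_zero (Finset.prod_ne_zero_iff.2 fun j _ => hP0 j)) h2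

theorem finrank_repairField_top (hα : ∀ i, (minpoly (ZMod p) (α i)).natDegree = P i)
    (hP0 : ∀ i, P i ≠ 0) (hP : Pairwise fun i j => (P i).Coprime (P j)) (hs : 0 < s)
    (hβ : (minpoly (pointField p α) β).natDegree = s)
    (hK : IntermediateField.adjoin (pointField p α) {β} = ⊤) (i : Fin n) :
    Module.finrank (repairField p α i) K = s * P i := by
  have h1 := Module.finrank_mul_finrank (ZMod p) (pointField p α) K
  have h2 := Module.finrank_mul_finrank (ZMod p) (repairField p α i) K
  rw [← h1, finrank_pointField hα hP0 hP, finrank_pointField_top hs hβ hK,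
    finrank_repairField hα hP0 hP, ← Finset.prod_erase_mul _ _ (Finset.mem_univ i), mul_assoc,
    mul_comm (P i)] at h2
  exact Nat.eq_of_mul_eq_mul_left
    (Nat.pos_of_ne_zero (Finset.prod_ne_zero_iff.2 fun j _ => hP0 j)) h2

theorem finite_of_adjoin_pointField (hα : ∀ i, (minpoly (ZMod p) (α i)).natDegree = P i)
    (hP0 : ∀ i, P i ≠ 0) (hP : Pairwise fun i j => (P i).Coprime (P j)) (hs : 0 < s)
    (hβ : (minpoly (pointField p α) β).natDegree = s)
    (hK : IntermediateField.adjoin (pointField p α) {β} = ⊤) : Finite K := by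
  have : FiniteDimensional (ZMod p) K := by
    refine FiniteDimensional.of_finrank_pos ?_
    rw [← Module.finrank_mul_finrank (ZMod p) (pointField p α) K, finrank_pointField hα hP0 hP,
      finrank_pointField_top hs hβ hK]
    exact Nat.mul_pos (Nat.pos_of_ne_zero (Finset.prod_ne_zero_iff.2 fun j _ => hP0 j)) hs
  exact Module.finite_of_finite (ZMod p)

/-- Expand first in powers of `β` over the point field, then each coefficient in powers of `α_i`
over the repair field. -/
theorem eq_top_of_mul_pow_mem (hα : ∀ i, (minpoly (ZMod p) (α i)).natDegree = P i)
    (hP0 : ∀ i, P i ≠ 0) (hP : Pairwise fun i j => (P i).Coprime (P j)) (hs : 0 < s)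
    (hβ : (minpoly (pointField p α) β).natDegree = s)
    (hK : IntermediateField.adjoin (pointField p α) {β} = ⊤) (i : Fin n)
    (W : Submodule (repairField p α i) K) (hW : ∀ u < s, ∀ t < P i, β ^ u * α i ^ t ∈ W) :
    W = ⊤ := by
  rw [eq_top_iff]
  rintro x -
  have hint : IsIntegral (pointField p α) β :=
    isIntegral_of_natDegree_minpoly_ne_zero (by omega)
  obtain ⟨g, hg, rfl⟩ := exists_aeval_eq_of_mem_adjoin_simple hint
    (y := x) (hK ▸ IntermediateField.mem_top)
  rw [aeval_eq_sum_range' (hg.trans_eq hβ)]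
  refine W.sum_mem fun u hu => ?_
  have hmem : (g.coeff u : K) ∈ IntermediateField.adjoin (repairField p α i) {α i} := by
    have hle : pointField p α ≤
        (IntermediateField.adjoin (repairField p α i) {α i}).restrictScalars (ZMod p) :=
      (restrictScalars_adjoin_repairField i).ge
    exact hle (g.coeff u).2
  obtain ⟨h, hh, hhu⟩ := exists_aeval_eq_of_mem_adjoin_simple
    (isIntegral_of_natDegree_minpoly_ne_zero ((hα i).trans_ne (hP0 i))).tower_top hmem
  rw [natDegree_minpoly_repairField hα hP0 hP] at hh
  rw [IntermediateField.smul_def, smul_eq_mul, ← hhu, aeval_eq_sum_range' hh, Finset.sum_mul]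
  refine W.sum_mem fun t ht => ?_
  rw [smul_mul_assoc, mul_comm]
  exact W.smul_mem _ (hW u (Finset.mem_range.1 hu) t (Finset.mem_range.1 ht))

end PointField

end

/-! ### The main theorem -/

theorem mainTheorem2 (p n k d e s : ℕ) [Fact p.Prime]
    (hk : 1 ≤ k) (hkd : k + 2 * e ≤ d) (hdn : d ≤ n - 1) (hs : s = d - 2 * e - k + 1)
    (P : Fin n → ℕ) (hP : ∀ i, (P i).Prime) (hPinj : Function.Injective P)
    (hPs : ∀ i, P i ≡ 1 [MOD s])
    {K : Type*} [Field K] [Algebra (ZMod p) K]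
    (α : Fin n → K) (hα : ∀ i, (minpoly (ZMod p) (α i)).natDegree = P i)
    (β : K) (hβ : (minpoly (pointField p α) β).natDegree = s)
    (hK : IntermediateField.adjoin (pointField p α) {β} = ⊤) :
    Function.Injective α ∧
    (∃ v : Fin n → K, (∀ j, v j ≠ 0) ∧ dualCode (rsCode k α) = grsCode (n - k) v α) ∧
    ∀ v : Fin n → K, (∀ j, v j ≠ 0) → dualCode (rsCode k α) = grsCode (n - k) v α →
    ∀ i : Fin n,
      Module.finrank (repairField p α i) K = s * P i ∧
      -- the matrices are invertible
      (∀ j : {j : Fin n // j ≠ i},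
        IsUnit (repairMatrix s (P i) (minpoly (repairField p α i) (α i)) (helperPoint p α i j))) ∧
      -- for each coordinate `m`, the vectors `(z_{j,m})_{j ≠ i}` lie in one fixed GRS code
      (∃ w : {j : Fin n // j ≠ i} → repairField p α i, (∀ j, w j ≠ 0) ∧
        ∀ c ∈ rsCode k α, ∀ m : Fin (P i),
          (fun j : {j : Fin n // j ≠ i} =>
            (repairMatrix s (P i) (minpoly (repairField p α i) (α i)) (helperPoint p α i j)).mulVec
              (traceVector (repairField p α i) s (P i) (α i) β (v j) (c j)) m) ∈
            grsCode (s + k - 1) w (helperPoint p α i)) ∧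
      -- repair of node `i` from any `d` helpers
      ∀ R : Finset (Fin n), i ∉ R → R.card = d →
        RepairsWithErrors (repairField p α i) (rsCode k α) i R e (fun _ => P i)
          (fun j x => traceVector (repairField p α i) s (P i) (α i) β (v j) x) ∧
        IsLeast (repairBandwidths (repairField p α i) (rsCode k α) i R e) (d * P i) ∧
        ((d * P i : ℕ) : ℚ) =
          d * Module.finrank (repairField p α i) K / ((d : ℚ) - 2 * e - k + 1) ∧
        -- the same with all symbols counted over the prime field
        ∃ N : ℕ, IsLeast (repairBandwidths (ZMod p) (rsCode k α) i R e) N ∧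
          (N : ℚ) = d * Module.finrank (ZMod p) K / ((d : ℚ) - 2 * e - k + 1) := by
  have hs0 : 0 < s := by omega
  have hP2 : ∀ i, 2 ≤ P i := fun i => (hP i).two_le
  have hP0 : ∀ i, P i ≠ 0 := fun i => (hP i).ne_zero
  have hPc : Pairwise fun i j => (P i).Coprime (P j) := fun i j hij =>
    (Nat.coprime_primes (hP i) (hP j)).2 (hPinj.ne hij)
  have hinj : Function.Injective α := fun i j h => hPinj (by rw [← hα, ← hα, h])
  have hα0 : ∀ j, α j ≠ 0 := fun j =>
    ne_zero_of_two_le_natDegree_minpoly (L := ZMod p) (by rw [hα]; exact hP2 j)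
  have hfin : Finite K := finite_of_adjoin_pointField hα hP0 hPc hs0 hβ hK
  refine ⟨hinj, ⟨Lagrange.nodalWeight Finset.univ α, fun j =>
    Lagrange.nodalWeight_ne_zero hinj.injOn (Finset.mem_univ j), ?_⟩, ?_⟩
  · have h := dualCode_rsCode hinj (m := k) (by rw [Fintype.card_fin]; omega)
    rwa [Fintype.card_fin] at h
  intro v hv hdual i
  -- `N` is the number `(P_i - 1)/s` of blocks; it is positive because `P_i ≥ 2`.
  obtain ⟨N, hN⟩ : ∃ N, P i = s * N + 1 := by
    obtain ⟨N, hN⟩ := (Nat.modEq_iff_dvd' (by have := hP2 i; omega)).1 (hPs i).symm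
    exact ⟨N, by have := hP2 i; omega⟩
  have hN0 : 0 < N := by
    rcases Nat.eq_zero_or_pos N with rfl | h
    · have := hP2 i
      omega
    · exact h
  have hrank := finrank_repairField_top hα hP0 hPc hs0 hβ hK i
  have hmin := natDegree_minpoly_repairField hα hP0 hPc i
  have hspan := eq_top_of_mul_pow_mem hα hP0 hPc hs0 hβ hK i
  have : Finite (repairField p α i) := Finite.of_injective _ Subtype.val_injective
  have : FiniteDimensional (repairField p α i) K := Module.Finite.of_finite
  have : FiniteDimensional (ZMod p) (repairField p α i) := Module.Finite.of_finite
  have ha : ∀ j, algebraMap (repairField p α i) K (helperPoint p α i j) = α j := fun _ => rfl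
  have hainj : Function.Injective (helperPoint p α i) := fun j j' h =>
    Subtype.ext (hinj (by rw [← ha, ← ha, h]))
  have hfa : ∀ j, (minpoly (repairField p α i) (α i)).eval (helperPoint p α i j) ≠ 0 := fun j =>
    eval_minpoly_ne_zero (by rw [hmin]; exact hP2 i) _
  refine ⟨hrank, fun j => isUnit_repairMatrix hs0 hN0 hN (minpoly.monic (.of_finite _ _)) hmin
      (fun h => hα0 j (by rw [← ha, h, map_zero])) (hfa j),
    ⟨Lagrange.nodalWeight Finset.univ (helperPoint p α i), fun j =>
      Lagrange.nodalWeight_ne_zero hainj.injOn (Finset.mem_univ j), fun c hc m =>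
      mulVec_traceVector_mem_grsCode hs0 hN0 hN hmin (by omega) ha hainj β hdual hc m⟩, ?_⟩
  intro R hiR hR
  have hRs : R.card + 1 = s + k + 2 * e := by omega
  have hrep := repairsWithErrors_traceVector hs0 hN0 hN hmin (by omega) hinj hα0 ha hfa hspan
    (hv i) hdual hiR hRs
  have hsQ : (d : ℚ) - 2 * e - k + 1 = s := by
    have : (d : ℚ) + 1 = s + k + 2 * e := by exact_mod_cast hR ▸ hRs
    linarith
  have hsQ0 : (s : ℚ) ≠ 0 := by exact_mod_cast hs0.ne'
  refine ⟨hrep, ⟨⟨_, _, hrep, ?_⟩, ?_⟩, ?_, ?_⟩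
  · simp [hR]
  · rintro M ⟨b, f, hf, rfl⟩
    have h := hf.card_mul_finrank_le hinj hiR hk hRs
    -- Since `l = s P_i`, the factor `s` cancels from `d l ≤ s ∑ b_j`.
    rw [hrank, hR, mul_left_comm] at h
    exact Nat.le_of_mul_le_mul_left h hs0
  · rw [hrank, hsQ, eq_div_iff hsQ0]
    push_cast
    ring
  · have hrankp := Module.finrank_mul_finrank (ZMod p) (repairField p α i) K
    rw [hrank] at hrankp
    obtain ⟨f, hf⟩ := hrep.restrictScalars (ZMod p)
    refine ⟨d * (P i * Module.finrank (ZMod p) (repairField p α i)), ⟨⟨_, _, hf, ?_⟩, ?_⟩, ?_⟩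
    · simp [hR]
    · rintro M ⟨b, f, hf, rfl⟩
      have h := hf.card_mul_finrank_le hinj hiR hk hRs
      rw [← hrankp, hR] at h
      refine Nat.le_of_mul_le_mul_left (le_trans (le_of_eq ?_) h) hs0
      ring
    · rw [← hrankp, hsQ, eq_div_iff hsQ0]
      push_cast
      ring
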